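/- **Definitions.** All groups are discrete. A *pointed dynamical system* $(G,X)$ consists of a group $G$ acting continuously on a compact metric space $(X,d)$ and a point $0\in X$ fixed by $G$. It is *expansive* if there is $0<\Delta\le 1$ such that $d(g\cdot x,g\cdot y)\le\Delta$ for all $g\in G$ implies $x=y$. A point $x$ is *homoclinic* if for every $\epsilon>0$ there is a finite $E\subseteq G$ with $d(g\cdot x,0)<\epsilon$ for all $g\in G\setminus E$. For $A,E\subseteq G$ let $\partial_E A=\{g\in A : Eg\not\subseteq A\}$. A *$(\delta,E)$-designation* is a family $(A_i,x_i)_{i\in I}$, where $(A_i)_{i\in I}$ is a partition of $G$ and $x_i\in X$, such that $d(g\cdot x_i,0)<\delta$ for all $i\in I$ and $g\in\partial_E A_i$; an *$\epsilon$-realization* of it is a point $y$ such that $d(g\cdot y,g\cdot x_i)<\epsilon$ for all $i\in I$ and $g\in A_i$. A *tiered dynamical system* (TDS) $\mathcal X$ consists of a compact metric space $X$ with a point $0\in X$; a directed set $\mathcal T$ with a least element $t_0$; for each $t\in\mathcal T$ an expansive pointed dynamical system $(G_t,X_t)$ with $0\in X_t\subseteq X$ (special point $0$, metric restricted from $X$),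 where $X_t\subseteq X_{t'}$ whenever $t\le t'$; and for $t\le t'$ a finite-to-one surjective homomorphism $\phi^{t'}_t:G_{t'}\to G_t$ with $\phi^t_t=\mathrm{id}$, $\phi^{t'}_t\circ\phi^{t''}_{t'}=\phi^{t''}_t$ for $t\le t'\le t''$, and $\phi^{t'}_t(g)\cdot x=g\cdot x$ for all $x\in X_t$, $g\in G_{t'}$. Its *base group* is $G_{t_0}$. An *evolution map* of $\mathcal X$ is a continuous $f:X\to X$ such that for all $t\le t'$ and $x\in X_t$ with $f(x)\in X_{t'}$ we have $f(\phi^{t'}_t(g)\cdot x)=g\cdot f(x)$ for all $g\in G_{t'}$. We say that * $\mathcal X$ is *$f$-stabilizing* if for every $t$ there is $s\ge t$ with $f^k(X_t)\subseteq X_s$ for all $k\in\mathbb N$; * $\mathcal X$ is *weakly $0$-gluing* if for every $t$ there is $w\ge t$ such that for all $\epsilon>0$ there are $\delta>0$ and a finite $E\subseteq G_w$ such that every $(\delta,E)$-designation $(A_i,x_i)_{i\in I}$ on $(G_w,X_w)$ with all $x_i\in X_t$ has an $\epsilon$-realization in $X_w$; * $\mathcal X$ has *weakly dense homoclinic points*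 if for all $t$, $x\in X_t$ and $\epsilon>0$ there are $t'\ge t$ and a point $y\in X_{t'}$, homoclinic in $(G_{t'},X_{t'})$, with $d(x,y)<\epsilon$. Let $\mathfrak C_2$ be the class of pairs $(\mathcal X,f)$ of a TDS and an evolution map of it such that $\mathcal X$ is $f$-stabilizing, weakly $0$-gluing and has weakly dense homoclinic points. Let $\mathfrak C_3\subseteq\mathfrak C_2$ consist of those pairs for which all groups $G_t$ are residually finite, and $\mathfrak C_4\subseteq\mathfrak C_2$ of those for which $\mathcal T$ has a single element. A group $G$ is *nil-rigid* on a class $\mathfrak C$ if for every TDS $\mathcal X$ with base group $G$ and every evolution map $f$ with $(\mathcal X,f)\in\mathfrak C$ and $\lim_{n\to\infty}f^n(x)=0$ for all $x\in X$, the following holds: for each tier $t$ there is $n\in\mathbb N$ with $f^n(x)=0$ for all $x\in X_t$. A group has a property *locally* if all its finitely generated subgroups have it. **Proposition.** Let $G$ be a group. If $G$ is locally nil-rigid on $\mathfrak C_2$ or locally nil-rigid on $\mathfrak C_4$, then $G$ is nil-rigid on $\mathfrak C_4$. Likewise, if $G$ is locally nil-rigid on $\mathfrak C_3$ and locally residually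 finite, then $G$ is nil-rigid on $\mathfrak C_4$. -/

import Mathlib

open Filter Topology

universe u v w

namespace NilRigid

section PointedSystems

variable (G : Type u) [Group G] {X : Type v} [MetricSpace X] [MulAction G X]

/-- `(G, X)` with special point `z` is a pointed dynamical system: `X` is a compact metric space,
the discrete group `G` acts continuously on it, and `z` is fixed by the action. -/
structure IsPointedSystem (z : X) : Prop where
  compact : CompactSpace X
  continuous_smul : ∀ g : G, Continuous fun x : X => g • x
  smul_zero : ∀ g : G, g • z = z

variable (X) in
/-- The action of `G` on `X` has an expansivity constant `0 < Δ ≤ 1`. -/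
def IsExpansive : Prop :=
  ∃ Δ : ℝ, 0 < Δ ∧ Δ ≤ 1 ∧ ∀ x y : X, (∀ g : G, dist (g • x) (g • y) ≤ Δ) → x = y

/-- The point `x` is homoclinic, with respect to the special point `z`. -/
def IsHomoclinic (z x : X) : Prop :=
  ∀ ε > (0 : ℝ), ∃ E : Finset G, ∀ g : G, g ∉ E → dist (g • x) z < ε

variable {G}

/-- The `E`-border `∂_E A` of `A`: those `g ∈ A` with `E g ⊈ A`. -/
def border (E A : Set G) : Set G := {g | g ∈ A ∧ ¬ ∀ e ∈ E, e * g ∈ A}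

/-- The family `(A i, x i)` is a designation: the sets `A i` partition the group. Empty cells
are harmless, since they impose no condition below, so it is enough to let the index type range
over the universe of the group. -/
structure IsDesignation {I : Type u} (A : I → Set G) (_x : I → X) : Prop where
  disjoint : Pairwise fun i j => Disjoint (A i) (A j)
  cover : ⋃ i, A i = Set.univ

/-- The family `(A i, x i)` is a `(δ, E)`-designation, with respect to the special point `z`. -/
structure IsDesignationWith (z : X) (δ : ℝ) (E : Set G) {I : Type u}
    (A : I → Set G) (x : I → X) : Prop extends IsDesignation A x where
  small : ∀ i, ∀ g ∈ border E (A i), dist (g • x i) z < δ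

/-- The point `y` is an `ε`-realization of the designation `(A i, x i)`. -/
def IsRealization (ε : ℝ) {I : Type u} (A : I → Set G) (x : I → X) (y : X) : Prop :=
  ∀ i, ∀ g ∈ A i, dist (g • y) (g • x i) < ε

end PointedSystems

/-- A tiered dynamical system. -/
structure TDS : Type (max u v w + 1) where
  /-- the ambient space -/
  X : Type v
  [metricSpace : MetricSpace X]
  [compactSpace : CompactSpace X]
  /-- the special point -/
  zero : X
  /-- the directed set of tiers, with least element `bot` -/
  T : Type w
  [preorder : Preorder T]
  [directed : IsDirectedOrder T]
  bot : T
  bot_le : ∀ t, bot ≤ t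
  /-- the group `G_t` -/
  Grp : T → Type u
  [group : ∀ t, Group (Grp t)]
  /-- the set `X_t` -/
  tier : T → Set X
  [action : ∀ t, MulAction (Grp t) (tier t)]
  zero_mem : ∀ t, zero ∈ tier t
  pointed : ∀ t, IsPointedSystem (Grp t) (⟨zero, zero_mem t⟩ : tier t)
  expansive : ∀ t, IsExpansive (Grp t) (tier t)
  tier_mono : ∀ {t t' : T}, t ≤ t' → tier t ⊆ tier t'
  /-- the homomorphism `φ^{t'}_t : G_{t'} → G_t` -/
  φ : ∀ {t t' : T}, t ≤ t' → Grp t' →* Grp t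
  φ_surjective : ∀ {t t' : T} (h : t ≤ t'), Function.Surjective (φ h)
  φ_finite : ∀ {t t' : T} (h : t ≤ t') (g : Grp t), {g' : Grp t' | φ h g' = g}.Finite
  φ_refl : ∀ t, φ (le_refl t) = MonoidHom.id (Grp t)
  φ_comp : ∀ {t t' t'' : T} (h : t ≤ t') (h' : t' ≤ t''), (φ h).comp (φ h') = φ (h.trans h')
  φ_smul : ∀ {t t' : T} (h : t ≤ t') (x : tier t) (g : Grp t'),
    ((φ h g • x : tier t) : X) = (g • Set.inclusion (tier_mono h) x : tier t')

namespace TDS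

attribute [instance] TDS.metricSpace TDS.compactSpace TDS.preorder TDS.directed TDS.group
  TDS.action

variable (𝒳 : TDS.{u, v, w})

/-- The special point as a point of the tier `t`. -/
def zeroIn (t : 𝒳.T) : 𝒳.tier t := ⟨𝒳.zero, 𝒳.zero_mem t⟩

/-- The continuous map `f` is an evolution map of the system. -/
structure IsEvolution (f : 𝒳.X → 𝒳.X) : Prop where
  continuous : Continuous f
  equivariant : ∀ {t t' : 𝒳.T} (h : t ≤ t') (x : 𝒳.tier t) (hfx : f x ∈ 𝒳.tier t')
    (g : 𝒳.Grp t'),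
    f (𝒳.φ h g • x : 𝒳.tier t) = (g • (⟨f x, hfx⟩ : 𝒳.tier t') : 𝒳.tier t')

/-- Every tier is `f`-stabilizing. -/
def IsStabilizing (f : 𝒳.X → 𝒳.X) : Prop :=
  ∀ t, ∃ s, t ≤ s ∧ ∀ k : ℕ, ∀ x ∈ 𝒳.tier t, f^[k] x ∈ 𝒳.tier s

/-- Every tier is weakly `0`-gluing. -/
def IsWeaklyZeroGluing : Prop :=
  ∀ t, ∃ s, ∃ h : t ≤ s, ∀ ε > (0 : ℝ), ∃ δ > (0 : ℝ), ∃ E : Finset (𝒳.Grp s),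
    ∀ (I : Type u) (A : I → Set (𝒳.Grp s)) (x : I → 𝒳.tier t),
      IsDesignationWith (𝒳.zeroIn s) δ (E : Set (𝒳.Grp s)) A
        (fun i => Set.inclusion (𝒳.tier_mono h) (x i)) →
      ∃ y : 𝒳.tier s, IsRealization ε A (fun i => Set.inclusion (𝒳.tier_mono h) (x i)) y

/-- The system has weakly dense homoclinic points. -/
def HasWeaklyDenseHomoclinic : Prop :=
  ∀ t, ∀ x ∈ 𝒳.tier t, ∀ ε > (0 : ℝ), ∃ t', t ≤ t' ∧ ∃ y : 𝒳.tier t',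
    dist x (y : 𝒳.X) < ε ∧ IsHomoclinic (𝒳.Grp t') (𝒳.zeroIn t') y

/-- `f` is nilpotent on the set `Y`. -/
def IsNilpotentOn (f : 𝒳.X → 𝒳.X) (Y : Set 𝒳.X) : Prop :=
  ∃ n : ℕ, ∀ x ∈ Y, f^[n] x = 𝒳.zero

/-- `f` is asymptotically nilpotent (on the ambient space). -/
def IsAsymptoticallyNilpotent (f : 𝒳.X → 𝒳.X) : Prop :=
  ∀ x, Tendsto (fun n : ℕ => f^[n] x) atTop (𝓝 𝒳.zero)

end TDS

/-- An evolution of a tiered dynamical system: a system with an evolution map. -/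
structure ETDS : Type (max u v w + 1) where
  sys : TDS.{u, v, w}
  f : sys.X → sys.X
  isEvolution : sys.IsEvolution f

/-- The class `ℭ₂`. -/
def C2 : Set ETDS.{u, v, w} :=
  {S | S.sys.IsStabilizing S.f ∧ S.sys.IsWeaklyZeroGluing ∧ S.sys.HasWeaklyDenseHomoclinic}

/-- The class `ℭ₃`: members of `ℭ₂` all of whose groups are residually finite. -/
def C3 : Set ETDS.{u, v, w} :=
  {S | S ∈ C2.{u, v, w} ∧ ∀ t, Group.ResiduallyFinite (S.sys.Grp t)}

/-- The class `ℭ₄`: members of `ℭ₂` with a single tier. -/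
def C4 : Set ETDS.{u, v, w} :=
  {S | S ∈ C2.{u, v, w} ∧ ∃ t₀ : S.sys.T, ∀ t, t = t₀}

/-- The tiered system is nil-rigid on the class `C`. -/
def TDS.IsNilRigidOn (𝒳 : TDS.{u, v, w}) (C : Set ETDS.{u, v, w}) : Prop :=
  ∀ (f : 𝒳.X → 𝒳.X) (hf : 𝒳.IsEvolution f), 𝒳.IsAsymptoticallyNilpotent f →
    (⟨𝒳, f, hf⟩ : ETDS) ∈ C → ∀ t, 𝒳.IsNilpotentOn f (𝒳.tier t)

/-- The group `G` is nil-rigid on the class `C`: every tiered system whose base group is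
(isomorphic to) `G` is nil-rigid on `C`. -/
def NilRigidOn (C : Set ETDS.{u, v, w}) (G : Type u) [Group G] : Prop :=
  ∀ 𝒳 : TDS.{u, v, w}, Nonempty (𝒳.Grp 𝒳.bot ≃* G) → 𝒳.IsNilRigidOn C

/-- Every finitely generated subgroup of `G` is nil-rigid on the class `C`. -/
def LocallyNilRigidOn (C : Set ETDS.{u, v, w}) (G : Type u) [Group G] : Prop :=
  ∀ H : Subgroup G, H.FG → NilRigidOn C H

/-- Every finitely generated subgroup of `G` is residually finite. -/
def LocallyResiduallyFinite (G : Type u) [Group G] : Prop :=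
  ∀ H : Subgroup G, H.FG → Group.ResiduallyFinite H

end NilRigid

namespace NilRigid

section SingleSystem

variable (G : Type u) [Group G] {W : Type v} [MetricSpace W] [MulAction G W]

/-! Let `Δ` be an expansivity constant and `ε = Δ / 2`. Gluing at precision `ε` needs one finite set
`E`, and by expansivity `f x` is known up to `ε` from `x` along one finite set `F`. Put `H = ⟨E ∪
F⟩` and let `Y` (`nearZeroOutside`) be the points whose orbit stays `ε`-close to zero off `H`.

Two points of `Y` are `Δ`-close off `H` for free, so `H` acts expansively on `Y`. As `E ⊆ H`,
distinct cosets `H g` do not interact, so designations of `H` extend by zero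
(`exists_realization_extend`) and any point can be cut off to lie in `Y` (`exists_cutoff`); this
gives gluing and dense homoclinic points in `Y`. As `F ⊆ H`, `f` preserves `Y`.

If `f^[n]` kills `Y`, comparing `x` with its cut-off shows that `f^[n] x` is `ε`-close to zero.
Applied to every `g • x`, this forces `f^[n] x = z` by expansivity (`exists_fg_subsystem`).
Nil-rigidity over finitely generated subgroups thus suffices (`nilRigidOn_C4_of_locally`). -/

/-- The system `(G, W)` is `0`-gluing, with respect to the special point `z`. -/
def IsZeroGluing (z : W) : Prop :=
  ∀ ε > (0 : ℝ), ∃ δ > (0 : ℝ), ∃ E : Finset G, ∀ (I : Type u) (A : I → Set G) (x : I → W),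
    IsDesignationWith z δ (E : Set G) A x → ∃ y : W, IsRealization ε A x y

/-- The homoclinic points of `(G, W)` are dense. -/
def HasDenseHomoclinic (z : W) : Prop :=
  ∀ x : W, ∀ ε > (0 : ℝ), ∃ y : W, dist x y < ε ∧ IsHomoclinic G z y

variable {G}

/-! ### Compactness: uniform expansivity and equicontinuity -/

/-- In an expansive system, points that stay `Δ`-close along a suitable finite set of group
elements are close. -/
theorem exists_finset_dist_lt [CompactSpace W] (hc : ∀ g : G, Continuous fun x : W => g • x)
    {Δ : ℝ} (hΔ : ∀ x y : W, (∀ g : G, dist (g • x) (g • y) ≤ Δ) → x = y)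
    {ρ : ℝ} (hρ : 0 < ρ) :
    ∃ F : Finset G, ∀ x y : W, (∀ g ∈ F, dist (g • x) (g • y) ≤ Δ) → dist x y < ρ := by
  have hK : IsCompact {p : W × W | ρ ≤ dist p.1 p.2} :=
    (isClosed_le continuous_const continuous_dist).isCompact
  -- By expansivity these closed conditions have no common solution among pairs at distance at least
  -- `ρ`, so finitely many already exclude them.
  obtain ⟨F, hF⟩ := hK.elim_finite_subfamily_closed
    (fun g : G => {p : W × W | dist (g • p.1) (g • p.2) ≤ Δ})
    (fun g => isClosed_le (((hc g).comp continuous_fst).dist ((hc g).comp continuous_snd))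
      continuous_const) (by
      rw [Set.eq_empty_iff_forall_notMem]
      rintro ⟨x, y⟩ ⟨h1, h2⟩
      have hxy : x = y := hΔ x y (by simpa using h2)
      subst hxy
      have h1 : ρ ≤ dist x x := h1
      rw [dist_self] at h1
      linarith)
  refine ⟨F, fun x y h => ?_⟩
  by_contra! hle
  rw [Set.eq_empty_iff_forall_notMem] at hF
  exact hF (x, y) ⟨hle, by simpa using h⟩

/-- Finitely many elements act uniformly equicontinuously on a compact space. -/
theorem exists_forall_dist_smul_lt [CompactSpace W] (hc : ∀ g : G, Continuous fun x : W => g • x)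
    (F : Finset G) {ρ : ℝ} (hρ : 0 < ρ) :
    ∃ δ > 0, ∀ g ∈ F, ∀ x y : W, dist x y < δ → dist (g • x) (g • y) < ρ := by
  classical
  induction F using Finset.induction_on with
  | empty => exact ⟨1, one_pos, by simp⟩
  | insert a s _ ih =>
    obtain ⟨δ, hδ, h⟩ := ih
    obtain ⟨η, hη, h'⟩ := Metric.uniformContinuous_iff.1
      (CompactSpace.uniformContinuous_of_continuous (hc a)) ρ hρ
    refine ⟨min δ η, lt_min hδ hη, fun g hg x y hxy => ?_⟩
    rcases Finset.mem_insert.1 hg with rfl | hg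
    · exact h' (hxy.trans_le (min_le_right _ _))
    · exact h g hg x y (hxy.trans_le (min_le_left _ _))

/-! ### The subsystem concentrated on a subgroup -/

/-- The points whose orbit stays `ε`-close to `z` outside of the subgroup `H`. -/
def nearZeroOutside (H : Subgroup G) (z : W) (ε : ℝ) : SubMulAction H W where
  carrier := {y | ∀ g : G, g ∉ H → dist (g • y) z ≤ ε}
  smul_mem' h y hy g hg := by
    rw [Subgroup.smul_def, smul_smul]
    exact hy _ fun hmem => hg ((H.mul_mem_cancel_right h.2).1 hmem)

theorem mem_nearZeroOutside {H : Subgroup G} {z : W} {ε : ℝ} {y : W} :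
    y ∈ nearZeroOutside H z ε ↔ ∀ g : G, g ∉ H → dist (g • y) z ≤ ε := Iff.rfl

theorem isPointedSystem_nearZeroOutside {z : W} (hP : IsPointedSystem G z) (H : Subgroup G)
    {ε : ℝ} (hz : z ∈ nearZeroOutside H z ε) :
    IsPointedSystem H (⟨z, hz⟩ : nearZeroOutside H z ε) where
  compact := by
    have := hP.compact
    refine isCompact_iff_compactSpace.1 (IsClosed.isCompact ?_)
    have : (nearZeroOutside H z ε : Set W) =
        ⋂ (g : G) (_ : g ∉ H), {y | dist (g • y) z ≤ ε} := by
      ext y; simp [mem_nearZeroOutside]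
    rw [this]
    exact isClosed_biInter fun g _ =>
      isClosed_le ((hP.continuous_smul g).dist continuous_const) continuous_const
  continuous_smul h :=
    ((hP.continuous_smul (h : G)).comp continuous_subtype_val).subtype_mk _
  smul_zero h := Subtype.ext (hP.smul_zero (h : G))

theorem expansive_nearZeroOutside {z : W} {H : Subgroup G} {ε Δ : ℝ} (hε : 2 * ε ≤ Δ)
    (hΔ : ∀ x y : W, (∀ g : G, dist (g • x) (g • y) ≤ Δ) → x = y)
    (x y : nearZeroOutside H z ε) (h : ∀ g : H, dist (g • x) (g • y) ≤ Δ) : x = y := by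
  refine Subtype.ext (hΔ _ _ fun g => ?_)
  by_cases hg : g ∈ H
  · exact h ⟨g, hg⟩
  · have h1 := x.2 g hg
    have h2 := y.2 g hg
    linarith [dist_triangle_right (g • (x : W)) (g • (y : W)) z]

/-- A designation of a subgroup, extended by the special point, can be realized up to `ε`. -/
theorem exists_realization_extend {z : W} (hP : IsPointedSystem G z) {H : Subgroup G} {ε δ : ℝ}
    (hδ : 0 < δ) {E : Finset G} (hE : ∀ e ∈ E, e ∈ H)
    (hglue : ∀ (I : Type u) (A : I → Set G) (x : I → W),
      IsDesignationWith z δ (E : Set G) A x → ∃ y : W, IsRealization ε A x y)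
    {I : Type u} (A : I → Set H) (x : I → W) (hA : IsDesignation A x)
    (hsmall : ∀ i, ∀ g ∈ border {e : H | (e : G) ∈ E} (A i), dist ((g : G) • x i) z < δ) :
    ∃ y ∈ nearZeroOutside H z ε, ∀ i, ∀ g ∈ A i, dist ((g : G) • y) ((g : G) • x i) < ε := by
  let B : Option I → Set G := fun o => o.elim {g | g ∉ H} fun i => Subtype.val '' A i
  let p : Option I → W := fun o => o.elim z x
  obtain ⟨y, hy⟩ := hglue (Option I) B p
    { disjoint := by
        rintro (_ | i) (_ | j) hij
        · exact absurd rfl hij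
        · rw [Set.disjoint_left]
          rintro g hg ⟨k, _, rfl⟩
          exact hg k.2
        · rw [Set.disjoint_left]
          rintro g ⟨k, _, rfl⟩ hg
          exact hg k.2
        · exact (Set.disjoint_image_iff Subtype.val_injective).2
            (hA.disjoint fun h => hij (congrArg some h))
      cover := by
        refine Set.eq_univ_of_forall fun g => Set.mem_iUnion.2 ?_
        by_cases hg : g ∈ H
        · obtain ⟨i, hi⟩ := Set.mem_iUnion.1
            (hA.cover.symm ▸ Set.mem_univ (⟨g, hg⟩ : H))
          exact ⟨some i, ⟨g, hg⟩, hi, rfl⟩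
        · exact ⟨none, hg⟩
      small := by
        rintro (_ | i) g ⟨hg, hgE⟩
        · show dist (g • z) z < δ
          rw [hP.smul_zero, dist_self]
          exact hδ
        -- Since `E ⊆ H`, the `E`-border of a cell inside `H` is computed within `H`.
        · obtain ⟨k, hk, rfl⟩ := hg
          refine hsmall i k ⟨hk, fun hall => hgE fun e he => ?_⟩
          exact ⟨⟨e, hE e he⟩ * k, hall _ he, rfl⟩ }
  refine ⟨y, fun g hg => ?_, fun i g hg => hy (some i) g ⟨g, hg, rfl⟩⟩
  have := hy none g hg
  have h' : dist (g • y) (g • z) < ε := this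
  rw [hP.smul_zero] at h'
  exact h'.le

/-- A point can be cut off outside of the subgroup. -/
theorem exists_cutoff {z : W} (hP : IsPointedSystem G z) {H : Subgroup G} {ε δ : ℝ}
    (hδ : 0 < δ) {E : Finset G} (hE : ∀ e ∈ E, e ∈ H)
    (hglue : ∀ (I : Type u) (A : I → Set G) (x : I → W),
      IsDesignationWith z δ (E : Set G) A x → ∃ y : W, IsRealization ε A x y) (x : W) :
    ∃ y ∈ nearZeroOutside H z ε, ∀ g ∈ H, dist (g • y) (g • x) < ε := by
  obtain ⟨y, hy, h⟩ := exists_realization_extend hP hδ hE hglue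
    (I := PUnit) (fun _ => Set.univ) (fun _ => x)
    ⟨fun i j hij => absurd (Subsingleton.elim i j) hij, Set.iUnion_const _⟩
    (fun i g hg => absurd (fun _ _ => Set.mem_univ _) hg.2)
  exact ⟨y, hy, fun g hg => h PUnit.unit ⟨g, hg⟩ trivial⟩

/-- Expansivity upgrades realizations at the single scale `ε` to every scale `ρ`: well inside a
cell, `ε`-closeness along `F * g` suffices; elsewhere both points are close to zero at `g`. -/
theorem isZeroGluing_nearZeroOutside {z : W} (hP : IsPointedSystem G z) {H : Subgroup G}
    {ε δ Δ : ℝ} (hε0 : 0 < ε) (hε : 2 * ε ≤ Δ)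
    (hΔ : ∀ x y : W, (∀ g : G, dist (g • x) (g • y) ≤ Δ) → x = y)
    (hδ : 0 < δ) {E : Finset G} (hE : ∀ e ∈ E, e ∈ H)
    (hglue : ∀ (I : Type u) (A : I → Set G) (x : I → W),
      IsDesignationWith z δ (E : Set G) A x → ∃ y : W, IsRealization ε A x y)
    (hz : z ∈ nearZeroOutside H z ε) :
    IsZeroGluing H (⟨z, hz⟩ : nearZeroOutside H z ε) := by
  classical
  intro ρ hρ
  have hPY := isPointedSystem_nearZeroOutside hP H hz
  have := hPY.compact
  obtain ⟨F, hF⟩ := exists_finset_dist_lt hPY.continuous_smul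
    (expansive_nearZeroOutside (z := z) (H := H) hε hΔ) (half_pos hρ)
  obtain ⟨η, hη, hηF⟩ := exists_forall_dist_smul_lt hPY.continuous_smul F hε0
  -- The inverses of `F` detect that `k * g` is a border point of its own cell when that cell misses
  -- `g`.
  let E' : Finset H := E.subtype (· ∈ H) ∪ (F ∪ F.image (·⁻¹))
  refine ⟨min (min δ η) (min ε (ρ / 2)), by positivity, E', fun I A x hA => ?_⟩
  have hEE' : ∀ e : H, (e : G) ∈ E → e ∈ E' := fun e he =>
    Finset.mem_union_left _ (Finset.mem_subtype.2 he)
  have hFE' : ∀ e ∈ F, e ∈ E' := fun e he =>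
    Finset.mem_union_right _ (Finset.mem_union_left _ he)
  have hFE'' : ∀ e ∈ F, e⁻¹ ∈ E' := fun e he =>
    Finset.mem_union_right _ (Finset.mem_union_right _ (Finset.mem_image_of_mem _ he))
  have hsm : ∀ i, ∀ g ∈ border (E' : Set H) (A i),
      dist (g • x i) (⟨z, hz⟩ : nearZeroOutside H z ε) < min (min δ η) (min ε (ρ / 2)) := hA.small
  obtain ⟨y, hy, hyr⟩ := exists_realization_extend hP hδ hE hglue A (fun i => (x i : W))
    ⟨hA.disjoint, hA.cover⟩ fun i g hg =>
      lt_of_lt_of_le (hsm i g ⟨hg.1, fun h => hg.2 fun e he => h e (hEE' e he)⟩)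
        ((min_le_left _ _).trans (min_le_left _ _))
  refine ⟨⟨y, hy⟩, fun i g hg => ?_⟩
  have hyr' : ∀ i, ∀ g ∈ A i,
      dist (g • (⟨y, hy⟩ : nearZeroOutside H z ε)) (g • x i) < ε := hyr
  by_cases hint : ∀ k ∈ F, k * g ∈ A i
  · refine (hF _ _ fun k hk => ?_).trans (half_lt_self hρ)
    rw [smul_smul, smul_smul]
    linarith [hyr' i _ (hint k hk)]
  · have hgi := hsm i g ⟨hg, fun h => hint fun k hk => h k (hFE' k hk)⟩
    -- At each `k * g`, `y` follows some `x j` that is small there: by equicontinuity if `j = i`, by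
    -- the border condition otherwise.
    have hy0 : dist (g • (⟨y, hy⟩ : nearZeroOutside H z ε)) ⟨z, hz⟩ < ρ / 2 := by
      refine hF _ _ fun k hk => ?_
      rw [smul_smul, hPY.smul_zero]
      obtain ⟨j, hj⟩ := Set.mem_iUnion.1 (hA.cover.symm ▸ Set.mem_univ (k * g))
      have hxj : dist ((k * g) • x j) (⟨z, hz⟩ : nearZeroOutside H z ε) < ε := by
        by_cases hgj : g ∈ A j
        · have hij : j = i := by
            by_contra hne
            exact Set.disjoint_left.1 (hA.disjoint hne) hgj hg
          subst hij
          have := hηF k hk _ _ (hgi.trans_le ((min_le_left _ _).trans (min_le_right _ _)))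
          rwa [smul_smul, hPY.smul_zero] at this
        · refine (hsm j (k * g) ⟨hj, fun h => hgj ?_⟩).trans_le
            ((min_le_right _ _).trans (min_le_left _ _))
          have := h k⁻¹ (hFE'' k hk)
          rwa [inv_mul_cancel_left] at this
      linarith [hyr' j _ hj, dist_triangle ((k * g) • (⟨y, hy⟩ : nearZeroOutside H z ε))
        ((k * g) • x j) ⟨z, hz⟩]
    have := hgi.trans_le ((min_le_right _ _).trans (min_le_right _ _))
    linarith [dist_triangle_right (g • (⟨y, hy⟩ : nearZeroOutside H z ε)) (g • x i) ⟨z, hz⟩]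

/-- Cutting off a nearby homoclinic point of `W` works: it is eventually `2 * ε`-close to zero along
`H`, which expansivity of `Y` turns into convergence to zero. -/
theorem hasDenseHomoclinic_nearZeroOutside {z : W} (hP : IsPointedSystem G z) {H : Subgroup G}
    {ε δ Δ : ℝ} (hε0 : 0 < ε) (hε : 2 * ε ≤ Δ)
    (hΔ : ∀ x y : W, (∀ g : G, dist (g • x) (g • y) ≤ Δ) → x = y)
    (hδ : 0 < δ) {E : Finset G} (hE : ∀ e ∈ E, e ∈ H)
    (hglue : ∀ (I : Type u) (A : I → Set G) (x : I → W),
      IsDesignationWith z δ (E : Set G) A x → ∃ y : W, IsRealization ε A x y)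
    (hdense : HasDenseHomoclinic G z)
    (hz : z ∈ nearZeroOutside H z ε) :
    HasDenseHomoclinic H (⟨z, hz⟩ : nearZeroOutside H z ε) := by
  classical
  intro x ρ hρ
  have hPY := isPointedSystem_nearZeroOutside hP H hz
  have := hPY.compact
  have := hP.compact
  have hexp := expansive_nearZeroOutside (z := z) (H := H) hε hΔ
  obtain ⟨F, hF⟩ := exists_finset_dist_lt hPY.continuous_smul hexp hρ
  obtain ⟨η, hη, hηF⟩ := exists_forall_dist_smul_lt hP.continuous_smul
    (F.image ((↑) : H → G)) hε0
  obtain ⟨p, hxp, hp⟩ := hdense x η hη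
  obtain ⟨y, hy, hyp⟩ := exists_cutoff hP hδ hE hglue p
  refine ⟨⟨y, hy⟩, hF _ _ fun k hk => ?_, fun σ hσ => ?_⟩
  · have h1 := hηF k (Finset.mem_image_of_mem _ hk) _ _ hxp
    have h2 := hyp k k.2
    have h3 := dist_triangle_right ((k : G) • (x : W)) ((k : G) • y) ((k : G) • p)
    have h4 : dist ((k : G) • (x : W)) ((k : G) • y) ≤ Δ := by linarith
    exact h4
  · obtain ⟨F', hF'⟩ := exists_finset_dist_lt hPY.continuous_smul hexp hσ
    obtain ⟨D, hD⟩ := hp ε hε0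
    refine ⟨F'.biUnion fun k => (D.subtype (· ∈ H)).image (k⁻¹ * ·), fun g hg => ?_⟩
    refine hF' _ _ fun k hk => ?_
    rw [smul_smul, hPY.smul_zero]
    have hkg : ((k * g : H) : G) ∉ D := fun hmem => hg <| Finset.mem_biUnion.2
      ⟨k, hk, Finset.mem_image.2 ⟨k * g, Finset.mem_subtype.2 hmem, inv_mul_cancel_left k g⟩⟩
    have h1 := hD _ hkg
    have h2 := hyp _ (k * g).2
    have h3 := dist_triangle (((k * g : H) : G) • y) (((k * g : H) : G) • p) z
    have h4 : dist (((k * g : H) : G) • y) z ≤ Δ := by linarith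
    exact h4

/-! ### Reduction to a finitely generated subgroup -/

/-- An evolution of an expansive `0`-gluing system with dense homoclinic points is controlled by
the evolution of a system of the same kind over a finitely generated subgroup. -/
theorem exists_fg_subsystem {z : W} (hP : IsPointedSystem G z) (hexp : IsExpansive G W)
    (hglue : IsZeroGluing G z) (hdense : HasDenseHomoclinic G z) {f : W → W}
    (hf : Continuous f) (hfG : ∀ (g : G) x, f (g • x) = g • f x) (hfz : f z = z) :
    ∃ H : Subgroup G, H.FG ∧ ∃ Y : SubMulAction H W, ∃ hz : z ∈ Y,
      (∀ y ∈ Y, f y ∈ Y) ∧ IsPointedSystem H (⟨z, hz⟩ : Y) ∧ IsExpansive H Y ∧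
      IsZeroGluing H (⟨z, hz⟩ : Y) ∧ HasDenseHomoclinic H (⟨z, hz⟩ : Y) ∧
      ∀ n : ℕ, (∀ y ∈ Y, f^[n] y = z) → ∀ x, f^[n] x = z := by
  classical
  have := hP.compact
  obtain ⟨Δ, hΔ0, hΔ1, hΔ⟩ := hexp
  obtain ⟨ε, hε0, hε⟩ : ∃ ε : ℝ, 0 < ε ∧ 2 * ε ≤ Δ := ⟨Δ / 2, by positivity, by linarith⟩
  obtain ⟨δ, hδ, E, hE⟩ := hglue ε hε0
  obtain ⟨η, hη, hfη⟩ := Metric.uniformContinuous_iff.1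
    (CompactSpace.uniformContinuous_of_continuous hf) ε hε0
  obtain ⟨F, hF⟩ := exists_finset_dist_lt hP.continuous_smul hΔ hη
  let H : Subgroup G := Subgroup.closure ((E ∪ F : Finset G) : Set G)
  have hEH : ∀ e ∈ E, e ∈ H := fun e he => Subgroup.subset_closure (Finset.mem_union_left _ he)
  have hFH : ∀ e ∈ F, e ∈ H := fun e he => Subgroup.subset_closure (Finset.mem_union_right _ he)
  have hz : z ∈ nearZeroOutside H z ε := fun g _ => by
    rw [hP.smul_zero, dist_self]; exact hε0.le
  -- `f` preserves `ε`-closeness along the subgroup `H`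
  have hstep : ∀ x y : W, (∀ g ∈ H, dist (g • x) (g • y) ≤ ε) → dist (f x) (f y) < ε := by
    intro x y h
    exact hfη (hF _ _ fun g hg => (h g (hFH g hg)).trans (by linarith))
  have hiter : ∀ (n : ℕ) (x y : W), (∀ g ∈ H, dist (g • x) (g • y) ≤ ε) →
      ∀ g ∈ H, dist (g • f^[n] x) (g • f^[n] y) ≤ ε := by
    intro n
    induction n with
    | zero => exact fun x y h => h
    | succ n ih =>
      intro x y h
      simp only [Function.iterate_succ_apply]
      refine ih _ _ fun g hg => ?_
      rw [← hfG, ← hfG]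
      refine (hstep _ _ fun k hk => ?_).le
      rw [smul_smul, smul_smul]
      exact h _ (H.mul_mem hk hg)
  refine ⟨H, ⟨E ∪ F, rfl⟩, nearZeroOutside H z ε, hz, fun y hy g hg => ?_,
    isPointedSystem_nearZeroOutside hP H hz,
    ⟨Δ, hΔ0, hΔ1, expansive_nearZeroOutside hε hΔ⟩,
    isZeroGluing_nearZeroOutside hP hε0 hε hΔ hδ hEH hE hz,
    hasDenseHomoclinic_nearZeroOutside hP hε0 hε hΔ hδ hEH hE hdense hz, fun n hn x => ?_⟩
  -- For `g ∉ H` the whole coset `H g` misses `H`, so `y` is `ε`-close to zero along it.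
  · rw [← hfG, ← hfz]
    refine (hstep _ _ fun k hk => ?_).le
    rw [smul_smul, hP.smul_zero]
    exact hy _ fun hmem => hg ((H.mul_mem_cancel_left hk).1 hmem)
  · have hfGn : ∀ (g : G) x, f^[n] (g • x) = g • f^[n] x := fun g =>
      (Function.Commute.iterate_left (f := f) (g := (g • ·)) (hfG g) n)
    have hclose : ∀ x, dist (f^[n] x) z ≤ ε := fun x => by
      obtain ⟨y, hy, hyx⟩ := exists_cutoff hP hδ hEH hE x
      have := hiter n x y (fun g hg => by rw [dist_comm]; exact (hyx g hg).le) 1 H.one_mem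
      rwa [one_smul, one_smul, hn y hy] at this
    refine hΔ _ _ fun g => ?_
    rw [← hfGn, hP.smul_zero]
    linarith [hclose (g • x)]

end SingleSystem

/-! ### Translation between single systems and tiered systems -/

namespace TDS

variable {G : Type u} [Group G] {W : Type v} [MetricSpace W] [MulAction G W]

/-- The action of `G` on `W`, as an action on the full subset. -/
instance univMulAction : MulAction G (Set.univ : Set W) where
  smul g x := ⟨g • (x : W), trivial⟩
  one_smul x := Subtype.ext (one_smul G (x : W))
  mul_smul g h x := Subtype.ext (mul_smul g h (x : W))

/-- A single expansive pointed system, as a tiered system with one tier. -/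
def ofSystem (z : W) (hP : IsPointedSystem G z) (hexp : IsExpansive G W) : TDS.{u, v, w} where
  X := W
  compactSpace := hP.compact
  zero := z
  T := PUnit
  bot := PUnit.unit
  bot_le _ := trivial
  Grp _ := G
  tier _ := Set.univ
  action _ := univMulAction
  zero_mem _ := trivial
  pointed _ :=
    { compact := isCompact_iff_compactSpace.1 (@isCompact_univ _ _ hP.compact)
      continuous_smul := fun g =>
        ((hP.continuous_smul g).comp continuous_subtype_val).subtype_mk _
      smul_zero := fun g => Subtype.ext (hP.smul_zero g) }
  expansive _ := by
    obtain ⟨Δ, h0, h1, h⟩ := hexp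
    exact ⟨Δ, h0, h1, fun x y hxy => Subtype.ext (h x y hxy)⟩
  tier_mono _ := subset_rfl
  φ _ := MonoidHom.id G
  φ_surjective _ := Function.surjective_id
  φ_finite _ g := Set.finite_singleton g
  φ_refl _ := rfl
  φ_comp _ _ := rfl
  φ_smul _ _ _ := rfl

variable {z : W} (hP : IsPointedSystem G z) (hexp : IsExpansive G W)

theorem isEvolution_ofSystem {f : W → W} (hf : Continuous f)
    (hfG : ∀ (g : G) x, f (g • x) = g • f x) : (ofSystem.{u, v, w} z hP hexp).IsEvolution f where
  continuous := hf
  equivariant _ x _ g := hfG g x.1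

theorem ofSystem_mem_C2 {f : W → W} (hglue : IsZeroGluing G z) (hdense : HasDenseHomoclinic G z)
    (hf : (ofSystem.{u, v, w} z hP hexp).IsEvolution f) :
    (⟨ofSystem.{u, v, w} z hP hexp, f, hf⟩ : ETDS) ∈ C2.{u, v, w} := by
  refine ⟨fun t => ⟨t, le_rfl, fun _ _ _ => trivial⟩, fun t => ⟨t, le_rfl, fun ε hε => ?_⟩,
    fun t x _ ε hε => ?_⟩
  · obtain ⟨δ, hδ, E, h⟩ := hglue ε hε
    refine ⟨δ, hδ, E, fun I A x hA => ?_⟩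
    obtain ⟨y, hy⟩ := h I A (fun i => (x i).1) ⟨⟨hA.disjoint, hA.cover⟩, hA.small⟩
    exact ⟨⟨y, trivial⟩, hy⟩
  · obtain ⟨y, hxy, hy⟩ := hdense x ε hε
    exact ⟨t, le_rfl, ⟨y, trivial⟩, hxy, hy⟩

theorem ofSystem_subsingleton (t : (ofSystem.{u, v, w} z hP hexp).T) :
    t = (ofSystem.{u, v, w} z hP hexp).bot := rfl

end TDS

theorem residuallyFinite_of_mulEquiv {G H : Type*} [Group G] [Group H] (e : G ≃* H)
    [Group.ResiduallyFinite H] : Group.ResiduallyFinite G := by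
  rw [Group.residuallyFinite_iff_forall_finiteIndexNormalSubgroup]
  intro g hg
  rw [← e.map_eq_one_iff]
  exact Group.eq_one_iff_forall_finiteIndexNormalSubroup _ fun K => hg (K.comap e.toMonoidHom)

/-- If the finitely generated subgroups of `G` are nil-rigid on a class containing all one-tier
members of `ℭ₂` over such a subgroup, then `G` is nil-rigid on `ℭ₄`. -/
theorem nilRigidOn_C4_of_locally {G : Type u} [Group G] {C : Set ETDS.{u, v, w}}
    (hC : ∀ S ∈ C4.{u, v, w}, ∀ H : Subgroup G, H.FG → (∀ t, Nonempty (S.sys.Grp t ≃* H)) → S ∈ C)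
    (h : LocallyNilRigidOn C G) : NilRigidOn C4.{u, v, w} G := by
  rintro 𝒳 ⟨e⟩ f hf hnil ⟨⟨hstab, hglue, hdense⟩, t₀, ht₀⟩ t
  obtain rfl : t = 𝒳.bot := (ht₀ t).trans (ht₀ _).symm
  have hle : ∀ s, s = 𝒳.bot := fun s => (ht₀ s).trans (ht₀ _).symm
  have hmaps : ∀ x ∈ 𝒳.tier 𝒳.bot, f x ∈ 𝒳.tier 𝒳.bot := by
    obtain ⟨s, _, hs⟩ := hstab 𝒳.bot
    obtain rfl := hle s
    exact hs 1
  -- Zero is the limit of its own orbit, hence fixed by continuity.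
  have hfz : f 𝒳.zero = 𝒳.zero := by
    have h1 := hnil 𝒳.zero
    have h2 := (hf.continuous.tendsto _).comp h1
    refine tendsto_nhds_unique h2 ?_
    refine ((tendsto_add_atTop_iff_nat 1).2 h1).congr fun n => ?_
    exact Function.iterate_succ_apply' f n _
  let F : 𝒳.tier 𝒳.bot → 𝒳.tier 𝒳.bot := fun x => ⟨f x, hmaps x x.2⟩
  have hFf : ∀ (n : ℕ) x, ((F^[n] x : 𝒳.tier 𝒳.bot) : 𝒳.X) = f^[n] x := fun n x =>
    (Function.Semiconj.iterate_right (f := Subtype.val) (ga := F) (gb := f) (fun _ => rfl) n) x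
  have hF : Continuous F := (hf.continuous.comp continuous_subtype_val).subtype_mk _
  have hFG : ∀ (g : 𝒳.Grp 𝒳.bot) x, F (g • x) = g • F x := fun g x => Subtype.ext <| by
    have := hf.equivariant (le_refl 𝒳.bot) x (hmaps x x.2) g
    rwa [𝒳.φ_refl] at this
  have hglue' : IsZeroGluing (𝒳.Grp 𝒳.bot) (𝒳.zeroIn 𝒳.bot) := by
    obtain ⟨s, hs, hg⟩ := hglue 𝒳.bot
    obtain rfl := hle s
    exact hg
  have hdense' : HasDenseHomoclinic (𝒳.Grp 𝒳.bot) (𝒳.zeroIn 𝒳.bot) := by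
    intro x ε hε
    obtain ⟨s, -, y, hxy, hy⟩ := hdense 𝒳.bot x x.2 ε hε
    obtain rfl := hle s
    exact ⟨y, hxy, hy⟩
  obtain ⟨H, hH, Y, hz, hFY, hPY, hexpY, hglueY, hdenseY, hnilY⟩ :=
    exists_fg_subsystem (𝒳.pointed 𝒳.bot) (𝒳.expansive 𝒳.bot) hglue' hdense' hF hFG
      (Subtype.ext hfz)
  -- The local hypothesis concerns subgroups of `G`, so `H` is transported along `e`.
  let K : Subgroup G := H.map e.toMonoidHom
  have hHK : Nonempty (H ≃* K) := ⟨e.subgroupMap H⟩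
  have hK : K.FG := (Subgroup.fg_iff_submonoid_fg K).2
    (((Subgroup.fg_iff_submonoid_fg H).1 hH).map e.toMonoidHom)
  let Φ : Y → Y := fun y => ⟨F y, hFY y y.2⟩
  have hΦF : ∀ (n : ℕ) y, ((Φ^[n] y : Y) : 𝒳.tier 𝒳.bot) = F^[n] y := fun n y =>
    (Function.Semiconj.iterate_right (f := Subtype.val) (ga := Φ) (gb := F) (fun _ => rfl) n) y
  have hev : (TDS.ofSystem.{u, v, w} _ hPY hexpY).IsEvolution Φ :=
    TDS.isEvolution_ofSystem hPY hexpY ((hF.comp continuous_subtype_val).subtype_mk _)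
      fun g y => Subtype.ext (hFG g y)
  have hasym : (TDS.ofSystem.{u, v, w} _ hPY hexpY).IsAsymptoticallyNilpotent Φ := by
    intro y
    refine tendsto_subtype_rng.2 (tendsto_subtype_rng.2 ?_)
    refine (hnil ((show Y from y).1 : 𝒳.X)).congr fun n => ?_
    exact ((congrArg Subtype.val (hΦF n y)).trans (hFf n _)).symm
  obtain ⟨n, hn⟩ := h K hK (TDS.ofSystem.{u, v, w} _ hPY hexpY) hHK Φ hev hasym
    (hC _ ⟨TDS.ofSystem_mem_C2 hPY hexpY hglueY hdenseY hev, _,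
      TDS.ofSystem_subsingleton hPY hexpY⟩ K hK fun _ => hHK) PUnit.unit
  refine ⟨n, fun x hx => ?_⟩
  have := hnilY n (fun (y : 𝒳.tier 𝒳.bot) hy => (hΦF n ⟨y, hy⟩).symm.trans
    (congrArg Subtype.val (hn (⟨y, hy⟩ : Y) trivial))) ⟨x, hx⟩
  rw [← hFf n ⟨x, hx⟩, this]

end NilRigid

theorem mainTheorem8 (G : Type u) [Group G] :
    (NilRigid.LocallyNilRigidOn NilRigid.C2.{u, v, w} G ∨
        NilRigid.LocallyNilRigidOn NilRigid.C4.{u, v, w} G →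
      NilRigid.NilRigidOn NilRigid.C4.{u, v, w} G) ∧
    (NilRigid.LocallyNilRigidOn NilRigid.C3.{u, v, w} G ∧ NilRigid.LocallyResiduallyFinite G →
      NilRigid.NilRigidOn NilRigid.C4.{u, v, w} G) := by
  refine ⟨?_, fun ⟨h, hrf⟩ => ?_⟩
  · rintro (h | h)
    · exact NilRigid.nilRigidOn_C4_of_locally (fun S hS _ _ _ => hS.1) h
    · exact NilRigid.nilRigidOn_C4_of_locally (fun S hS _ _ _ => hS) h
  · refine NilRigid.nilRigidOn_C4_of_locally (C := NilRigid.C3)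
      (fun S hS H hH hiso => ⟨hS.1, fun t => ?_⟩) h
    obtain ⟨e⟩ := hiso t
    have := hrf H hH
    exact NilRigid.residuallyFinite_of_mulEquiv e
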